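/- Let $\mathcal H$ be a complex Hilbert space with inner product linear in the second argument, and let $K$ be a bounded and boundedly invertible operator on $\mathcal H$. An operator $T$ in $\mathcal H$ is called $K$-invariant if $K^*TK=T$, including equality of domains, where $\mathcal D(K^*TK)=\{f : Kf\in\mathcal D(T)\}$. Let $S$ be a densely defined, closed, symmetric operator in $\mathcal H$ that is strictly positive (there is $\varepsilon>0$ with $\langle f,Sf\rangle\ge\varepsilon\|f\|^2$ for all $f\in\mathcal D(S)$) and $K$-invariant, and assume that $\dim\ker(S^*)<\infty$. Let $S_F$ be the Friedrichs extension of $S$, i.e. the restriction of $S^*$ to the set of all $f\in\mathcal D(S^*)$ for which there is a sequence $(f_n)$ in $\mathcal D(S)$ with $f_n\to f$ and $\langle f_n-f_m,S(f_n-f_m)\rangle\to0$ as $n,m\to\infty$. Let $B$ be an operator with $\overline{\mathcal D(B)}\subseteq\ker(S^*)$ that is nonnegative and self-adjoint in the Hilbert space $\overline{\mathcal D(B)}$, and let $S_B$ be the corresponding nonnegative self-adjoint extension of $S$, i.e. the restriction of $S^*$ to $$\mathcal D(S_B)=\mathcal D(S)+\{S_F^{-1}Bf+f : f\in\mathcal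 D(B)\}+\{S_F^{-1}\eta : \eta\in\mathcal D(B)^\perp\cap\ker(S^*)\}.$$ If $S_B$ is $K$-invariant, then $K\mathcal D(B)\subseteq\mathcal D(B)$, so that $\widetilde K:=K\upharpoonright_{\mathcal D(B)}$ is a linear map of $\mathcal D(B)$ into itself, and $$\mathcal C:=\operatorname{span}\bigl\{\mathcal R(\zeta,\widetilde K) : \zeta\in\sigma(\widetilde K),\ |\zeta|\ne1\bigr\}\subseteq\ker(B),$$ where $\mathcal R(\zeta,\widetilde K)=\{\eta\in\mathcal D(B) : (\widetilde K-\zeta)^n\eta=0\text{ for some }n\in\mathbb N\}$. -/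

import Mathlib

namespace KInvExt

open Filter
open scoped Topology InnerProductSpace LinearPMap

/-- `⟨f, T f⟩` for `f ∈ D(T)`; the real part is the whole value when `T` is symmetric. -/
noncomputable def quadForm {H : Type*} [NormedAddCommGroup H] [InnerProductSpace ℂ H]
    (T : H →ₗ.[ℂ] H) (f : T.domain) : ℝ :=
  (⟪(f : H), T f⟫_ℂ).re

/-- `T` is a densely defined symmetric operator. -/
structure IsSymmetricOp {H : Type*} [NormedAddCommGroup H] [InnerProductSpace ℂ H]
    (T : H →ₗ.[ℂ] H) : Prop where
  dense : Dense (T.domain : Set H)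
  symm : ∀ f g : T.domain, ⟪T f, (g : H)⟫_ℂ = ⟪(f : H), T g⟫_ℂ

/-- `T ≥ 0`. -/
def IsNonneg {H : Type*} [NormedAddCommGroup H] [InnerProductSpace ℂ H]
    (T : H →ₗ.[ℂ] H) : Prop :=
  ∀ f : T.domain, 0 ≤ quadForm T f

/-- `T ≥ ε I` for some `ε > 0`. -/
def IsStrictlyPositive {H : Type*} [NormedAddCommGroup H] [InnerProductSpace ℂ H]
    (T : H →ₗ.[ℂ] H) : Prop :=
  ∃ ε : ℝ, 0 < ε ∧ ∀ f : T.domain, ε * ‖(f : H)‖ ^ 2 ≤ quadForm T f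

theorem IsStrictlyPositive.isNonneg {H : Type*} [NormedAddCommGroup H] [InnerProductSpace ℂ H]
    {T : H →ₗ.[ℂ] H} (h : IsStrictlyPositive T) : IsNonneg T := by
  obtain ⟨ε, hε, h⟩ := h
  exact fun f => le_trans (by positivity) (h f)

/-- The kernel of a partially defined operator, as a subspace of the ambient space. -/
def kernel {H : Type*} [NormedAddCommGroup H] [InnerProductSpace ℂ H]
    (T : H →ₗ.[ℂ] H) : Submodule ℂ H :=
  (LinearMap.ker T.toFun).map T.domain.subtype

/-- The operator `K* T K` on its natural domain `{f | K f ∈ D(T)}`. -/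
noncomputable def conjOp {H : Type*} [NormedAddCommGroup H] [InnerProductSpace ℂ H]
    [CompleteSpace H] (K : H →L[ℂ] H) (T : H →ₗ.[ℂ] H) : H →ₗ.[ℂ] H where
  domain := T.domain.comap (K : H →ₗ[ℂ] H)
  toFun := (K.adjoint : H →ₗ[ℂ] H) ∘ₗ T.toFun ∘ₗ
    ((K : H →ₗ[ℂ] H).restrict (p := T.domain.comap (K : H →ₗ[ℂ] H)) (q := T.domain)
      fun _ hf => hf)

/-- `T` is `K`-invariant: `K* T K = T`, domains included. -/
def KInvariant {H : Type*} [NormedAddCommGroup H] [InnerProductSpace ℂ H]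
    [CompleteSpace H] (K : H ≃L[ℂ] H) (T : H →ₗ.[ℂ] H) : Prop :=
  conjOp (K : H →L[ℂ] H) T = T

theorem quadForm_add_le {H : Type*} [NormedAddCommGroup H] [InnerProductSpace ℂ H]
    {T : H →ₗ.[ℂ] H} (h : IsNonneg T) (f g : T.domain) :
    quadForm T (f + g) ≤ 2 * quadForm T f + 2 * quadForm T g := by
  have h1 := h (f - g)
  simp only [quadForm, LinearPMap.map_sub, LinearPMap.map_add, Submodule.coe_sub,
    Submodule.coe_add, inner_sub_left, inner_sub_right, inner_add_left, inner_add_right,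
    Complex.sub_re, Complex.add_re] at h1 ⊢
  linarith

theorem quadForm_smul {H : Type*} [NormedAddCommGroup H] [InnerProductSpace ℂ H]
    (T : H →ₗ.[ℂ] H) (c : ℂ) (f : T.domain) :
    quadForm T (c • f) = ‖c‖ ^ 2 * quadForm T f := by
  simp only [quadForm, LinearPMap.map_smul, Submodule.coe_smul, inner_smul_left,
    inner_smul_right, ← mul_assoc, Complex.mul_conj']
  rw [← Complex.ofReal_pow, Complex.re_ofReal_mul]

/-- Domain of the Friedrichs extension of a nonnegative symmetric `S`: those `f ∈ D(S*)` that are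
limits of sequences in `D(S)` which are Cauchy for the quadratic form of `S`. -/
noncomputable def friedrichsDomain {H : Type*} [NormedAddCommGroup H] [InnerProductSpace ℂ H]
    [CompleteSpace H] (S : H →ₗ.[ℂ] H) (hS : IsNonneg S) : Submodule ℂ H where
  carrier := {f | f ∈ S†.domain ∧ ∃ u : ℕ → S.domain,
    Tendsto (fun n => (u n : H)) atTop (𝓝 f) ∧
    Tendsto (fun p : ℕ × ℕ => quadForm S (u p.1 - u p.2)) (atTop ×ˢ atTop) (𝓝 0)}
  zero_mem' := ⟨zero_mem _, fun _ => 0, by simp, by simp [quadForm]⟩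
  add_mem' := by
    rintro f g ⟨hf, u, hu, hu'⟩ ⟨hg, v, hv, hv'⟩
    refine ⟨add_mem hf hg, fun n => u n + v n, by simpa using hu.add hv, ?_⟩
    refine squeeze_zero (fun p => hS _) (fun p => ?_)
      (by simpa using (hu'.const_mul 2).add (hv'.const_mul 2))
    rw [add_sub_add_comm]
    exact quadForm_add_le hS _ _
  smul_mem' := by
    rintro c f ⟨hf, u, hu, hu'⟩
    refine ⟨Submodule.smul_mem _ c hf, fun n => c • u n, by simpa using hu.const_smul c, ?_⟩
    simp only [← smul_sub, quadForm_smul]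
    simpa using hu'.const_mul (‖c‖ ^ 2)

/-- The Friedrichs extension `S_F`, the restriction of `S*` to `friedrichsDomain`. -/
noncomputable def friedrichs {H : Type*} [NormedAddCommGroup H] [InnerProductSpace ℂ H]
    [CompleteSpace H] (S : H →ₗ.[ℂ] H) (hS : IsNonneg S) : H →ₗ.[ℂ] H where
  domain := friedrichsDomain S hS
  toFun := S†.toFun ∘ₗ Submodule.inclusion fun _ hf => hf.1

/-- An operator `B` in `H` whose values lie in the closure of `D(B)`, regarded as an operator in
the Hilbert space `closure D(B)`. -/
def inClosure {H : Type*} [NormedAddCommGroup H] [InnerProductSpace ℂ H]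
    (B : H →ₗ.[ℂ] H) (hB : ∀ f : B.domain, B f ∈ B.domain.topologicalClosure) :
    B.domain.topologicalClosure →ₗ.[ℂ] B.domain.topologicalClosure where
  domain := B.domain.comap B.domain.topologicalClosure.subtype
  toFun := (B.toFun.codRestrict B.domain.topologicalClosure hB) ∘ₗ
    (B.domain.topologicalClosure.subtype.restrict
      (p := B.domain.comap B.domain.topologicalClosure.subtype) (q := B.domain) fun _ hf => hf)

/-- `B` is an auxiliary operator for `S`: a nonnegative self-adjoint operator in the Hilbert space
`closure D(B)`, which is contained in `ker S*`. -/
structure IsAuxiliary {H : Type*} [NormedAddCommGroup H] [InnerProductSpace ℂ H]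
    [CompleteSpace H] (S B : H →ₗ.[ℂ] H) : Prop where
  closure_le : B.domain.topologicalClosure ≤ kernel S†
  map_mem : ∀ f : B.domain, B f ∈ B.domain.topologicalClosure
  selfAdjoint : IsSelfAdjoint (inClosure B map_mem)
  nonneg : IsNonneg B

/-- The domain
`D(S_B) = D(S) + {S_F⁻¹ B f + f | f ∈ D(B)} + {S_F⁻¹ η | η ∈ D(B)ᗮ ∩ ker S*}`. Here `u` and `v` are
`S_F⁻¹ B f` and `S_F⁻¹ η`, that is, the elements of `D(S_F)` with `S_F u = B f` and `S_F v = η`. -/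
noncomputable def extDomain {H : Type*} [NormedAddCommGroup H] [InnerProductSpace ℂ H]
    [CompleteSpace H] (S : H →ₗ.[ℂ] H) (hS : IsNonneg S) (B : H →ₗ.[ℂ] H) : Submodule ℂ H where
  carrier := {ψ | ∃ (f₀ : S.domain) (f : B.domain) (η : H) (u v : (friedrichs S hS).domain),
    η ∈ B.domainᗮ ⊓ kernel S† ∧ friedrichs S hS u = B f ∧ friedrichs S hS v = η ∧
    ψ = f₀ + (u + f) + v}
  zero_mem' := ⟨0, 0, 0, 0, 0, zero_mem _, by simp, by simp, by simp⟩
  add_mem' := by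
    rintro _ _ ⟨f₀, f, η, u, v, h1, h2, h3, rfl⟩ ⟨f₀', f', η', u', v', h1', h2', h3', rfl⟩
    refine ⟨f₀ + f₀', f + f', η + η', u + u', v + v', add_mem h1 h1', ?_, ?_, ?_⟩
    · rw [LinearPMap.map_add, LinearPMap.map_add, h2, h2']
    · rw [LinearPMap.map_add, h3, h3']
    · push_cast; abel
  smul_mem' := by
    rintro c _ ⟨f₀, f, η, u, v, h1, h2, h3, rfl⟩
    refine ⟨c • f₀, c • f, c • η, c • u, c • v, Submodule.smul_mem _ c h1, ?_, ?_, ?_⟩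
    · rw [LinearPMap.map_smul, LinearPMap.map_smul, h2]
    · rw [LinearPMap.map_smul, h3]
    · push_cast; simp only [smul_add]

/-- The extension `S_B` of `S`: the restriction of `S*` to `D(S_B)`, which is contained in `D(S*)`
whenever `S` is symmetric and `D(B) ⊆ ker S*`. -/
noncomputable def extOp {H : Type*} [NormedAddCommGroup H] [InnerProductSpace ℂ H]
    [CompleteSpace H] (S : H →ₗ.[ℂ] H) (hS : IsNonneg S) (B : H →ₗ.[ℂ] H) : H →ₗ.[ℂ] H :=
  S†.domRestrict (extDomain S hS B)

theorem extOp_domain {H : Type*} [NormedAddCommGroup H] [InnerProductSpace ℂ H]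
    [CompleteSpace H] {S : H →ₗ.[ℂ] H} (hsymm : IsSymmetricOp S) (hS : IsNonneg S)
    {B : H →ₗ.[ℂ] H} (hB : IsAuxiliary S B) :
    (extOp S hS B).domain = extDomain S hS B := by
  refine inf_eq_left.mpr ?_
  rintro _ ⟨f₀, f, η, u, v, -, -, -, rfl⟩
  have hker : kernel S† ≤ S†.domain := by
    rintro _ ⟨x, -, rfl⟩
    exact x.2
  have hle : S ≤ S† := LinearPMap.IsFormalAdjoint.le_adjoint hsymm.dense hsymm.symm
  exact add_mem (add_mem (hle.1 f₀.2) (add_mem u.2.1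
    (hker (hB.closure_le (Submodule.le_topologicalClosure _ f.2))))) v.2.1

/-- The sum of the root spaces `{η | ∃ n, (A - ζ)ⁿ η = 0}` of `A` over all `ζ ∈ σ(A)`
with `|ζ| ≠ 1`. -/
noncomputable def nonunitaryRootSpan {V : Type*} [AddCommGroup V] [Module ℂ V]
    (A : Module.End ℂ V) : Submodule ℂ V :=
  ⨆ ζ ∈ {ζ : ℂ | ζ ∈ spectrum ℂ A ∧ ‖ζ‖ ≠ 1}, A.maxGenEigenspace ζ

end KInvExt

/-!
The sesquilinear form of a nonnegative symmetric operator `T` turns `D(T)` into a pre-Hilbert space.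
If `S ≥ ε`, then `D(S) ↪ H` is bounded for the energy norm and extends to the completion as a
bounded operator `J` with `⟪J e, S g⟫ = ⟪e, g⟫`. Consequently `D(S_F) = D(S*) ∩ ran J`, the inverse
of `S_F` is `J J*`, and `D(S_F) ∩ ker S* = 0`.

The last fact makes the `ker S*`-component of an element of `D(S_B)` unique, and this component
lies in `D(B)`. As `S_F` and `ker S*` inherit the invariance under `K`, applying `K` to
`S_F⁻¹ B f + f` shows that `K` preserves `D(B)` and the form of `B`. In other words, `K` is an
isometry of the pre-Hilbert space `D(B)`, whose root vectors for `|ζ| ≠ 1` must have norm zero;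
since `B ≥ 0`, they lie in `ker B`.
-/

namespace KInvExt

open Filter UniformSpace
open scoped Topology InnerProductSpace LinearPMap

/-- An isometry `A` scales `x` by `|ζ|` in norm if `(A - ζ) x` has norm zero, so the claim follows
by induction on the order of the root vector. -/
theorem norm_eq_zero_of_mem_maxGenEigenspace {𝕜 E : Type*} [NormedField 𝕜]
    [SeminormedAddCommGroup E] [NormedSpace 𝕜 E] {A : Module.End 𝕜 E} (hA : ∀ x, ‖A x‖ = ‖x‖)
    {ζ : 𝕜} (hζ : ‖ζ‖ ≠ 1) {x : E} (hx : x ∈ A.maxGenEigenspace ζ) : ‖x‖ = 0 := by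
  obtain ⟨n, hn⟩ := (A.mem_maxGenEigenspace ζ x).1 hx
  clear hx
  induction n generalizing x with
  | zero => simpa using congrArg norm hn
  | succ n ih =>
    rw [pow_succ, Module.End.mul_apply] at hn
    have hnull : ‖A x - ζ • x‖ = 0 := by simpa using ih hn
    have hscale : ‖x‖ = ‖ζ‖ * ‖x‖ := by
      have hle := abs_norm_sub_norm_le (A x) (ζ • x)
      rw [hnull, hA, norm_smul] at hle
      exact sub_eq_zero.1 (abs_nonpos_iff.1 hle)
    by_contra hne
    exact hζ (mul_right_cancel₀ hne (by rw [← hscale, one_mul]))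

section FormDomain

variable {H : Type*} [NormedAddCommGroup H] [InnerProductSpace ℂ H] {T : H →ₗ.[ℂ] H}

/-- The domain of a nonnegative symmetric operator `T` (not necessarily densely defined), as a type
of its own: it carries the semi-inner product `⟪f, T g⟫` instead of that of the ambient space. -/
def FormDomain (_hT : T.IsFormalAdjoint T) (_hpos : IsNonneg T) : Type _ := T.domain

namespace FormDomain

variable (hT : T.IsFormalAdjoint T) (hpos : IsNonneg T)

instance : AddCommGroup (FormDomain hT hpos) := inferInstanceAs (AddCommGroup T.domain)

instance : Module ℂ (FormDomain hT hpos) := inferInstanceAs (Module ℂ T.domain)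

/-- The semi-inner product `⟪f, T g⟫` on `D(T)`. -/
noncomputable instance core : PreInnerProductSpace.Core ℂ (FormDomain hT hpos) where
  inner f g := ⟪(f : T.domain).1, T g⟫_ℂ
  conj_inner_symm f g := by rw [inner_conj_symm]; exact hT f g
  re_inner_nonneg := hpos
  add_left _ _ _ := inner_add_left _ _ _
  smul_left _ _ _ := inner_smul_left _ _ _

noncomputable instance : SeminormedAddCommGroup (FormDomain hT hpos) :=
  InnerProductSpace.Core.toSeminormedAddCommGroup (𝕜 := ℂ)

noncomputable instance : InnerProductSpace ℂ (FormDomain hT hpos) :=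
  InnerProductSpace.ofCore (core hT hpos)

end FormDomain

theorem quadForm_eq_zero_of_mem_maxGenEigenspace (hT : T.IsFormalAdjoint T) (hpos : IsNonneg T)
    {A : Module.End ℂ T.domain} (hA : ∀ f, quadForm T (A f) = quadForm T f)
    {ζ : ℂ} (hζ : ‖ζ‖ ≠ 1) {f : T.domain} (hf : f ∈ A.maxGenEigenspace ζ) :
    quadForm T f = 0 := by
  have hnorm : √(quadForm T f) = 0 :=
    norm_eq_zero_of_mem_maxGenEigenspace (E := FormDomain hT hpos) (A := A)
      (fun g => congrArg Real.sqrt (hA g)) hζ hf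
  exact (Real.sqrt_eq_zero (hpos f)).1 hnorm

/-- The energy space of a nonnegative symmetric operator `T`: the Hilbert space completion of `D(T)`
for the semi-inner product `⟪f, T g⟫`. -/
abbrev EnergySpace (hT : T.IsFormalAdjoint T) (hpos : IsNonneg T) : Type _ :=
  Completion (FormDomain hT hpos)

/-- The canonical map from `D(T)` to the energy space of `T`. -/
noncomputable def toEnergySpace (hT : T.IsFormalAdjoint T) (hpos : IsNonneg T) :
    T.domain →ₗ[ℂ] EnergySpace hT hpos :=
  (Completion.toComplL (𝕜 := ℂ) (E := FormDomain hT hpos)).toLinearMap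

section EnergySpace

variable (hT : T.IsFormalAdjoint T) (hpos : IsNonneg T)

theorem inner_toEnergySpace (f g : T.domain) :
    ⟪toEnergySpace hT hpos f, toEnergySpace hT hpos g⟫_ℂ = ⟪(f : H), T g⟫_ℂ :=
  Completion.inner_coe (E := FormDomain hT hpos) f g

theorem norm_toEnergySpace (f : T.domain) : ‖toEnergySpace hT hpos f‖ = √(quadForm T f) :=
  Completion.norm_coe (E := FormDomain hT hpos) f

theorem denseRange_toEnergySpace : DenseRange (toEnergySpace hT hpos) :=
  Completion.denseRange_coe (α := FormDomain hT hpos)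

theorem cauchySeq_toEnergySpace_iff {u : ℕ → T.domain} :
    CauchySeq (fun n => toEnergySpace hT hpos (u n)) ↔
      Tendsto (fun p : ℕ × ℕ => quadForm T (u p.1 - u p.2)) (atTop ×ˢ atTop) (𝓝 0) := by
  rw [cauchySeq_iff_tendsto_dist_atTop_0, ← prod_atTop_atTop_eq]
  simp only [dist_eq_norm, ← map_sub, norm_toEnergySpace]
  refine ⟨fun h => ?_, fun h => by simpa using h.sqrt⟩
  simpa [Real.sq_sqrt (hpos _)] using h.pow 2

theorem exists_seq_tendsto_toEnergySpace (e : EnergySpace hT hpos) :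
    ∃ u : ℕ → T.domain, Tendsto (fun n => toEnergySpace hT hpos (u n)) atTop (𝓝 e) := by
  obtain ⟨x, hx, hlim⟩ := mem_closure_iff_seq_limit.1 (denseRange_toEnergySpace hT hpos e)
  choose u hu using hx
  exact ⟨u, hlim.congr fun n => (hu n).symm⟩

end EnergySpace

theorem inner_apply_eq_zero_of_quadForm_eq_zero (hT : T.IsFormalAdjoint T) (hpos : IsNonneg T)
    {f : T.domain} (hf : quadForm T f = 0) (g : T.domain) : ⟪(g : H), T f⟫_ℂ = 0 := by
  rw [← inner_toEnergySpace hT hpos]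
  exact inner_eq_zero_of_right _ (by rw [norm_toEnergySpace, hf, Real.sqrt_zero])

theorem exists_norm_le_norm_toEnergySpace (hT : T.IsFormalAdjoint T)
    (hpos : IsStrictlyPositive T) :
    ∃ C : ℝ, ∀ f : T.domain, ‖(f : H)‖ ≤ C * ‖toEnergySpace hT hpos.isNonneg f‖ := by
  obtain ⟨ε, hε, hle⟩ := id hpos
  refine ⟨√ε⁻¹, fun f => ?_⟩
  rw [norm_toEnergySpace, ← Real.sqrt_mul (by positivity)]
  exact Real.le_sqrt_of_sq_le ((le_inv_mul_iff₀ hε).2 (hle f))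

variable [CompleteSpace H]

/-- The continuous extension to the energy space of the inclusion of `D(T)` in `H`, for a strictly
positive symmetric operator `T`. -/
noncomputable def energyEmbedding (hT : T.IsFormalAdjoint T) (hpos : IsStrictlyPositive T) :
    EnergySpace hT hpos.isNonneg →L[ℂ] H :=
  T.domain.subtype.extendOfNorm (toEnergySpace hT hpos.isNonneg)

section energyEmbedding

variable (hT : T.IsFormalAdjoint T) (hpos : IsStrictlyPositive T)

theorem energyEmbedding_toEnergySpace (f : T.domain) :
    energyEmbedding hT hpos (toEnergySpace hT hpos.isNonneg f) = f :=
  LinearMap.extendOfNorm_eq (denseRange_toEnergySpace hT hpos.isNonneg)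
    (exists_norm_le_norm_toEnergySpace hT hpos) f

theorem inner_energyEmbedding_apply (e : EnergySpace hT hpos.isNonneg) (g : T.domain) :
    ⟪energyEmbedding hT hpos e, T g⟫_ℂ = ⟪e, toEnergySpace hT hpos.isNonneg g⟫_ℂ := by
  induction e using (denseRange_toEnergySpace hT hpos.isNonneg).induction_on with
  | hp => exact isClosed_eq (by fun_prop) (by fun_prop)
  | ih f => rw [energyEmbedding_toEnergySpace, inner_toEnergySpace]

theorem mem_friedrichsDomain_iff {f : H} : f ∈ friedrichsDomain T hpos.isNonneg ↔
    f ∈ T†.domain ∧ ∃ e, energyEmbedding hT hpos e = f := by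
  have tendsto_of_tendsto {u : ℕ → T.domain} {e : EnergySpace hT hpos.isNonneg}
      (hu : Tendsto (fun n => toEnergySpace hT hpos.isNonneg (u n)) atTop (𝓝 e)) :
      Tendsto (fun n => (u n : H)) atTop (𝓝 (energyEmbedding hT hpos e)) := by
    simpa only [Function.comp_def, energyEmbedding_toEnergySpace] using
      ((energyEmbedding hT hpos).continuous.tendsto e).comp hu
  refine and_congr_right fun _ => ⟨?_, ?_⟩
  · rintro ⟨u, hu, hform⟩
    obtain ⟨e, he⟩ := cauchySeq_tendsto_of_complete
      ((cauchySeq_toEnergySpace_iff hT hpos.isNonneg).2 hform)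
    exact ⟨e, tendsto_nhds_unique (tendsto_of_tendsto he) hu⟩
  · rintro ⟨e, rfl⟩
    obtain ⟨u, hu⟩ := exists_seq_tendsto_toEnergySpace hT hpos.isNonneg e
    exact ⟨u, tendsto_of_tendsto hu,
      (cauchySeq_toEnergySpace_iff hT hpos.isNonneg).1 hu.cauchySeq⟩

end energyEmbedding
end FormDomain

section Friedrichs

variable {H : Type*} [NormedAddCommGroup H] [InnerProductSpace ℂ H] {S : H →ₗ.[ℂ] H}

theorem mem_kernel_iff {f : H} : f ∈ kernel S ↔ ∃ hf : f ∈ S.domain, S ⟨f, hf⟩ = 0 := by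
  constructor
  · rintro ⟨g, hg, rfl⟩
    exact ⟨g.2, hg⟩
  · rintro ⟨hf, hzero⟩
    exact ⟨⟨f, hf⟩, hzero, rfl⟩

theorem IsSymmetricOp.isFormalAdjoint (hS : IsSymmetricOp S) : S.IsFormalAdjoint S := hS.symm

variable [CompleteSpace H]

theorem inner_apply_eq_zero_of_mem_kernel_adjoint (hS : Dense (S.domain : Set H)) {f : H}
    (hf : f ∈ kernel S†) (g : S.domain) : ⟪f, S g⟫_ℂ = 0 := by
  obtain ⟨hdom, hzero⟩ := mem_kernel_iff.1 hf
  rw [← LinearPMap.adjoint_isFormalAdjoint hS ⟨f, hdom⟩ g, hzero, inner_zero_left]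

theorem IsSymmetricOp.le_friedrichs (hS : IsSymmetricOp S) (hpos : IsNonneg S) :
    S ≤ friedrichs S hpos := by
  have hle : S ≤ S† := LinearPMap.IsFormalAdjoint.le_adjoint hS.dense hS.isFormalAdjoint
  exact ⟨fun f hf => ⟨hle.1 hf, fun _ => ⟨f, hf⟩, tendsto_const_nhds, by simp [quadForm]⟩,
    fun _ g hfg => hle.2 (y := ⟨g, g.2.1⟩) hfg⟩

theorem disjoint_friedrichsDomain_kernel_adjoint (hS : IsSymmetricOp S)
    (hpos : IsStrictlyPositive S) :
    Disjoint (friedrichsDomain S hpos.isNonneg) (kernel S†) := by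
  refine Submodule.disjoint_def.2 fun f hf hker => ?_
  obtain ⟨-, e, rfl⟩ := (mem_friedrichsDomain_iff hS.isFormalAdjoint hpos).1 hf
  have he : e = 0 := by
    refine (denseRange_toEnergySpace _ _).eq_zero_of_inner_left ℂ fun g => ?_
    rw [← inner_energyEmbedding_apply hS.isFormalAdjoint hpos]
    exact inner_apply_eq_zero_of_mem_kernel_adjoint hS.dense hker g
  rw [he, map_zero]

theorem friedrichs_surjective (hS : IsSymmetricOp S) (hpos : IsStrictlyPositive S) :
    Function.Surjective (friedrichs S hpos.isNonneg) := by
  intro h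
  set J := energyEmbedding hS.isFormalAdjoint hpos
  have hweak (g : S.domain) : ⟪h, (g : H)⟫_ℂ = ⟪J (J.adjoint h), S g⟫_ℂ := by
    rw [inner_energyEmbedding_apply, ContinuousLinearMap.adjoint_inner_left,
      energyEmbedding_toEnergySpace]
  have hdom : J (J.adjoint h) ∈ S†.domain :=
    LinearPMap.mem_adjoint_domain_of_exists _ ⟨h, hweak⟩
  exact ⟨⟨_, (mem_friedrichsDomain_iff hS.isFormalAdjoint hpos).2 ⟨hdom, _, rfl⟩⟩,
    LinearPMap.adjoint_apply_eq hS.dense ⟨_, hdom⟩ hweak⟩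

end Friedrichs

section Invariance

variable {H : Type*} [NormedAddCommGroup H] [InnerProductSpace ℂ H] [CompleteSpace H]
  {K : H ≃L[ℂ] H} {T : H →ₗ.[ℂ] H}

theorem kInvariant_iff : KInvariant K T ↔ ∀ f, (K f ∈ T.domain ↔ f ∈ T.domain) ∧
    ∀ (hf : f ∈ T.domain) (hKf : K f ∈ T.domain),
      (K : H →L[ℂ] H).adjoint (T ⟨K f, hKf⟩) = T ⟨f, hf⟩ := by
  constructor
  · intro hK f
    have hdom : (conjOp (K : H →L[ℂ] H) T).domain = T.domain := congrArg LinearPMap.domain hK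
    have hle : conjOp (K : H →L[ℂ] H) T ≤ T := le_of_eq hK
    exact ⟨iff_of_eq (congrArg (f ∈ ·) hdom),
      fun hf hKf => hle.2 (x := ⟨f, hKf⟩) (y := ⟨f, hf⟩) rfl⟩
  · intro h
    refine LinearPMap.ext (Submodule.ext fun f => (h f).1) ?_
    rintro f hKf hf
    exact (h f).2 hf hKf

namespace KInvariant

theorem mem_domain_iff (hK : KInvariant K T) {f : H} : K f ∈ T.domain ↔ f ∈ T.domain :=
  (kInvariant_iff.1 hK f).1

theorem inner_map_map (hK : KInvariant K T) (g : H) {f : H} (hf : f ∈ T.domain)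
    (hKf : K f ∈ T.domain) : ⟪K g, T ⟨K f, hKf⟩⟫_ℂ = ⟪g, T ⟨f, hf⟩⟫_ℂ := by
  rw [← (kInvariant_iff.1 hK f).2 hf hKf, ContinuousLinearMap.adjoint_inner_right]
  rfl

protected theorem symm (hK : KInvariant K T) : KInvariant K.symm T := by
  refine kInvariant_iff.2 fun f => ⟨?_, fun hf hKf => ext_inner_left ℂ fun g => ?_⟩
  · rw [← hK.mem_domain_iff, K.apply_symm_apply]
  · have h := hK.inner_map_map (K.symm g) hKf (by simpa using hf)
    simp only [K.apply_symm_apply] at h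
    rw [ContinuousLinearMap.adjoint_inner_right, h]
    rfl

theorem map_mem_kernel (hK : KInvariant K T) {f : H} (hf : f ∈ kernel T) : K f ∈ kernel T := by
  obtain ⟨hdom, hzero⟩ := mem_kernel_iff.1 hf
  refine mem_kernel_iff.2 ⟨hK.mem_domain_iff.2 hdom, ext_inner_left ℂ fun g => ?_⟩
  rw [← K.apply_symm_apply g, hK.inner_map_map _ hdom, hzero, inner_zero_right, inner_zero_right]

theorem map_mem_adjoint_domain (hK : KInvariant K T) (hT : Dense (T.domain : Set H)) {f : H}
    (hf : f ∈ T†.domain) : K f ∈ T†.domain := by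
  refine LinearPMap.mem_adjoint_domain_of_exists _
    ⟨(K.symm : H →L[ℂ] H).adjoint (T† ⟨f, hf⟩), fun g => ?_⟩
  have hKg := hK.symm.mem_domain_iff.2 g.2
  have h := LinearPMap.adjoint_isFormalAdjoint hT ⟨f, hf⟩ ⟨K.symm g, hKg⟩
  rw [ContinuousLinearMap.adjoint_inner_left, ← hK.symm.inner_map_map (K f) g.2 hKg,
    K.symm_apply_apply]
  exact h

protected theorem adjoint (hK : KInvariant K T) (hT : Dense (T.domain : Set H)) :
    KInvariant K T† := by
  refine kInvariant_iff.2 fun f => ⟨⟨fun hKf => ?_, hK.map_mem_adjoint_domain hT⟩,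
    fun hf hKf => (LinearPMap.adjoint_apply_eq hT ⟨f, hf⟩ fun g => ?_).symm⟩
  · simpa using hK.symm.map_mem_adjoint_domain hT hKf
  · have hKg := hK.mem_domain_iff.2 g.2
    have h := LinearPMap.adjoint_isFormalAdjoint hT ⟨K f, hKf⟩ ⟨K g, hKg⟩
    rw [ContinuousLinearMap.adjoint_inner_left, ← hK.inner_map_map f g.2 hKg]
    exact h

theorem map_mem_friedrichsDomain (hK : KInvariant K T) (hT : Dense (T.domain : Set H))
    (hpos : IsNonneg T) {f : H} (hf : f ∈ friedrichsDomain T hpos) :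
    K f ∈ friedrichsDomain T hpos := by
  obtain ⟨hdom, u, hu, hform⟩ := hf
  let A : Module.End ℂ T.domain := (K : H →ₗ[ℂ] H).restrict fun _ => hK.mem_domain_iff.2
  have hA (g : T.domain) : quadForm T (A g) = quadForm T g :=
    congrArg Complex.re (hK.inner_map_map g g.2 (A g).2)
  refine ⟨hK.map_mem_adjoint_domain hT hdom, fun n => A (u n),
    (K.continuous.tendsto f).comp hu, ?_⟩
  simpa only [← map_sub, hA] using hform

protected theorem friedrichs (hK : KInvariant K T) (hT : Dense (T.domain : Set H))
    (hpos : IsNonneg T) : KInvariant K (friedrichs T hpos) := by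
  refine kInvariant_iff.2 fun f => ⟨⟨fun hKf => ?_, hK.map_mem_friedrichsDomain hT hpos⟩,
    fun hf hKf => (kInvariant_iff.1 (hK.adjoint hT) f).2 hf.1 hKf.1⟩
  have h := hK.symm.map_mem_friedrichsDomain hT hpos hKf
  rwa [K.symm_apply_apply] at h

end KInvariant
end Invariance

namespace IsAuxiliary

variable {H : Type*} [NormedAddCommGroup H] [InnerProductSpace ℂ H] [CompleteSpace H]
  {S B : H →ₗ.[ℂ] H}

theorem isFormalAdjoint (hB : IsAuxiliary S B) : B.IsFormalAdjoint B := by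
  have hadj := LinearPMap.adjoint_isFormalAdjoint hB.selfAdjoint.dense_domain
  rw [LinearPMap.isSelfAdjoint_def.1 hB.selfAdjoint] at hadj
  exact fun f g => hadj ⟨⟨f, Submodule.le_topologicalClosure _ f.2⟩, f.2⟩
    ⟨⟨g, Submodule.le_topologicalClosure _ g.2⟩, g.2⟩

theorem apply_eq_zero_of_quadForm_eq_zero (hB : IsAuxiliary S B) {f : B.domain}
    (hf : quadForm B f = 0) : B f = 0 := by
  have horth : B f ∈ B.domain.topologicalClosureᗮ := by
    rw [Submodule.orthogonal_closure]
    exact (Submodule.mem_orthogonal _ _).2 fun g hg =>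
      inner_apply_eq_zero_of_quadForm_eq_zero hB.isFormalAdjoint hB.nonneg hf ⟨g, hg⟩
  exact Submodule.disjoint_def.1 (Submodule.orthogonal_disjoint _) _ (hB.map_mem f) horth

theorem domain_le_kernel_adjoint (hB : IsAuxiliary S B) : B.domain ≤ kernel S† :=
  (Submodule.le_topologicalClosure _).trans hB.closure_le

theorem exists_inner_friedrichs_eq (hB : IsAuxiliary S B) (hS : IsSymmetricOp S)
    (hpos : IsStrictlyPositive S) (w : (friedrichs S hpos.isNonneg).domain) {f : H}
    (hf : f ∈ kernel S†) (hwf : w + f ∈ extDomain S hpos.isNonneg B) :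
    ∃ hfB : f ∈ B.domain, ∀ g ∈ B.domain,
      ⟪g, friedrichs S hpos.isNonneg w⟫_ℂ = ⟪g, B ⟨f, hfB⟩⟫_ℂ := by
  obtain ⟨f₀, f', η, u, v, hη, hu, hv, hsum⟩ := hwf
  have hle := hS.le_friedrichs hpos.isNonneg
  let w' : (friedrichs S hpos.isNonneg).domain := ⟨f₀, hle.1 f₀.2⟩ + u + v
  have hsub : f - f' = w' - w := by
    rw [sub_eq_sub_iff_add_eq_add, add_comm, hsum]
    simp only [w', Submodule.coe_add]
    abel
  have hzero : f - f' = 0 :=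
    Submodule.disjoint_def.1 (disjoint_friedrichsDomain_kernel_adjoint hS hpos) _
      (hsub ▸ sub_mem w'.2 w.2) (sub_mem hf (hB.domain_le_kernel_adjoint f'.2))
  obtain rfl : f = f' := sub_eq_zero.1 hzero
  obtain rfl : w = w' := (Subtype.ext (sub_eq_zero.1 (hsub ▸ hzero))).symm
  refine ⟨f'.2, fun g hg => ?_⟩
  have hSf₀ : ⟪g, S f₀⟫_ℂ = 0 :=
    inner_apply_eq_zero_of_mem_kernel_adjoint hS.dense (hB.domain_le_kernel_adjoint hg) f₀
  have hgη : ⟪g, η⟫_ℂ = 0 := (Submodule.mem_orthogonal _ _).1 hη.1 g hg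
  have hf₀ : friedrichs S hpos.isNonneg ⟨f₀, hle.1 f₀.2⟩ = S f₀ := (hle.2 rfl).symm
  rw [LinearPMap.map_add, LinearPMap.map_add, hf₀, hu, hv, inner_add_right, inner_add_right,
    hSf₀, hgη, zero_add, add_zero]

theorem exists_inner_map_map (hB : IsAuxiliary S B) (hS : IsSymmetricOp S)
    (hpos : IsStrictlyPositive S) {K : H ≃L[ℂ] H} (hK : KInvariant K S)
    (hinv : KInvariant K (extOp S hpos.isNonneg B)) (f : B.domain) :
    ∃ hKf : K f ∈ B.domain, ∀ g : H, K g ∈ B.domain →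
      ⟪K g, B ⟨K f, hKf⟩⟫_ℂ = ⟪g, B f⟫_ℂ := by
  obtain ⟨u, hu⟩ := friedrichs_surjective hS hpos (B f)
  have hKF := hK.friedrichs hS.dense hpos.isNonneg
  have hKu := hKF.mem_domain_iff.2 u.2
  have hmem : (u : H) + f ∈ extDomain S hpos.isNonneg B :=
    ⟨0, f, 0, u, 0, zero_mem _, hu, LinearPMap.map_zero _, by simp⟩
  have hKmem : K u + K f ∈ extDomain S hpos.isNonneg B := by
    rw [← extOp_domain hS hpos.isNonneg hB] at hmem ⊢
    simpa only [map_add] using hinv.mem_domain_iff.2 hmem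
  obtain ⟨hKf, hinner⟩ := hB.exists_inner_friedrichs_eq hS hpos ⟨K u, hKu⟩
    ((hK.adjoint hS.dense).map_mem_kernel (hB.domain_le_kernel_adjoint f.2)) hKmem
  refine ⟨hKf, fun g hg => ?_⟩
  rw [← hinner _ hg, hKF.inner_map_map g u.2, hu]

end IsAuxiliary

end KInvExt

theorem mainTheorem7_general {H : Type*} [NormedAddCommGroup H] [InnerProductSpace ℂ H]
    [CompleteSpace H] (K : H ≃L[ℂ] H) (S : H →ₗ.[ℂ] H)
    (hsymm : KInvExt.IsSymmetricOp S) (hpos : KInvExt.IsStrictlyPositive S)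
    (hK : KInvExt.KInvariant K S) (B : H →ₗ.[ℂ] H) (hB : KInvExt.IsAuxiliary S B)
    (hinv : KInvExt.KInvariant K (KInvExt.extOp S hpos.isNonneg B)) :
    ∃ hKB : ∀ f ∈ B.domain, (K : H →ₗ[ℂ] H) f ∈ B.domain,
      (KInvExt.nonunitaryRootSpan ((K : H →ₗ[ℂ] H).restrict hKB)).map B.domain.subtype
        ≤ KInvExt.kernel B := by
  have hiso := hB.exists_inner_map_map hsymm hpos hK hinv
  refine ⟨fun f hf => (hiso ⟨f, hf⟩).1, Submodule.map_mono (iSup₂_le fun ζ hζ f hf => ?_)⟩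
  have hnull : KInvExt.quadForm B f = 0 :=
    KInvExt.quadForm_eq_zero_of_mem_maxGenEigenspace hB.isFormalAdjoint hB.nonneg
      (fun g => congrArg Complex.re ((hiso g).2 g (hiso g).1)) hζ.2 hf
  exact hB.apply_eq_zero_of_quadForm_eq_zero hnull

theorem mainTheorem7 {H : Type*} [NormedAddCommGroup H] [InnerProductSpace ℂ H] [CompleteSpace H]
    (K : H ≃L[ℂ] H) (S : H →ₗ.[ℂ] H)
    (hsymm : KInvExt.IsSymmetricOp S) (hclosed : S.IsClosed)
    (hpos : KInvExt.IsStrictlyPositive S) (hK : KInvExt.KInvariant K S)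
    (hfin : FiniteDimensional ℂ (KInvExt.kernel S.adjoint))
    (B : H →ₗ.[ℂ] H) (hB : KInvExt.IsAuxiliary S B)
    (hinv : KInvExt.KInvariant K (KInvExt.extOp S hpos.isNonneg B)) :
    ∃ hKB : ∀ f ∈ B.domain, (K : H →ₗ[ℂ] H) f ∈ B.domain,
      (KInvExt.nonunitaryRootSpan ((K : H →ₗ[ℂ] H).restrict hKB)).map B.domain.subtype
        ≤ KInvExt.kernel B :=
  mainTheorem7_general K S hsymm hpos hK B hB hinv
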